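/- Let $\mathcal H$ be a complex Hilbert space. For a bounded operator $A$ on $\mathcal H$ and $1\le p<\infty$ put $|A|=(A^*A)^{1/2}$ and $\|A\|_p=[\operatorname{Tr}|A|^p]^{1/p}\in[0,\infty]$, where the trace of a positive operator $T$ is $\operatorname{Tr}T=\sum_i\langle e_i,Te_i\rangle\in[0,\infty]$ for any orthonormal basis $(e_i)$ of $\mathcal H$. The operator $A$ is called trace class if $\operatorname{Tr}|A|<\infty$. A state is a positive trace class operator of trace $1$. Let $1<p<\infty$. (i) Let $A_0$ and $(A_n)_{n\ge 1}$ be trace class operators on $\mathcal H$, with $A_0$ normal and $\|A_0\|_1=\|A_n\|_1=1$ for all $n$. If $\|A_0-A_n\|_p\to 0$, then $\|A_0-A_n\|_1\to 0$. (ii) The topologies induced on the set of states by the norms $\|\cdot\|_1$ and $\|\cdot\|_p$ coincide. -/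

import Mathlib

open scoped ENNReal InnerProductSpace

noncomputable section

variable {H : Type*} [NormedAddCommGroup H] [InnerProductSpace ℂ H] [CompleteSpace H]

/-- The trace `∑ i, ⟪e i, T (e i)⟫`, with values in `[0, ∞]`, of a positive bounded operator `T`,
computed in a fixed orthonormal (Hilbert) basis `e` of `H`. By `posTrace_eq_tsum` below, the value
does not depend on the basis. It is only used for positive operators. -/
def posTrace (T : H →L[ℂ] H) : ℝ≥0∞ :=
  ∑' i, ENNReal.ofReal
    (⟪(exists_hilbertBasis ℂ H).choose_spec.choose i,
      T ((exists_hilbertBasis ℂ H).choose_spec.choose i)⟫_ℂ).re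

theorem HilbertBasis.tsum_enorm_inner_sq {ι : Type*} (b : HilbertBasis ι ℂ H) (x : H) :
    ∑' i, ENNReal.ofReal (‖⟪b i, x⟫_ℂ‖ ^ 2) = ENNReal.ofReal (‖x‖ ^ 2) := by
  have h := b.hasSum_inner_mul_inner x x
  have h2 : HasSum (fun i => ‖⟪b i, x⟫_ℂ‖ ^ 2) (‖x‖ ^ 2) := by
    have h3 := Complex.hasSum_re h
    have e1 : ∀ i, (⟪x, b i⟫_ℂ * ⟪b i, x⟫_ℂ).re = ‖⟪b i, x⟫_ℂ‖ ^ 2 := by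
      intro i
      rw [← inner_conj_symm x (b i), mul_comm, Complex.mul_conj, Complex.ofReal_re,
        Complex.normSq_eq_norm_sq]
    have e2 : (⟪x, x⟫_ℂ).re = ‖x‖ ^ 2 := by
      rw [inner_self_eq_norm_sq_to_K]; norm_cast
    simpa only [e1, e2] using h3
  rw [← h2.tsum_eq, ENNReal.ofReal_tsum_of_nonneg (fun _ => by positivity) h2.summable]

theorem posTrace_eq_tsum {ι : Type*} (b : HilbertBasis ι ℂ H) {T : H →L[ℂ] H}
    (hT : T.IsPositive) :
    posTrace T = ∑' i, ENNReal.ofReal (⟪b i, T (b i)⟫_ℂ).re := by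
  have hT0 : 0 ≤ T := (ContinuousLinearMap.nonneg_iff_isPositive T).2 hT
  set S := CFC.sqrt T with hS
  have hSS : S * S = T := CFC.sqrt_mul_sqrt_self T hT0
  have hSsa : IsSelfAdjoint S := (CFC.sqrt_nonneg T).isSelfAdjoint
  have sym : ∀ x y, ⟪S x, y⟫_ℂ = ⟪x, S y⟫_ℂ := fun x y =>
    (ContinuousLinearMap.isSelfAdjoint_iff_isSymmetric.1 hSsa) x y
  have key : ∀ x, (⟪x, T x⟫_ℂ).re = ‖S x‖ ^ 2 := by
    intro x
    rw [← hSS, show (S * S) x = S (S x) from rfl, ← sym, inner_self_eq_norm_sq_to_K]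
    norm_cast
  unfold posTrace
  generalize (exists_hilbertBasis ℂ H).choose_spec.choose = c
  simp only [key]
  simp_rw [fun i => (c.tsum_enorm_inner_sq (S (b i))).symm,
    fun i => (b.tsum_enorm_inner_sq (S (c i))).symm]
  rw [ENNReal.tsum_comm]
  simp_rw [← sym (c _), norm_inner_symm]

/-- The Schatten `p`-norm `(Tr |A|^p)^(1/p)`, with values in `[0, ∞]`, where `|A| = (A^* A)^(1/2)`
and the powers of `|A|` are those of the continuous functional calculus. -/
def schattenNorm (p : ℝ) (A : H →L[ℂ] H) : ℝ≥0∞ :=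
  posTrace (CFC.abs A ^ p) ^ (1 / p)

variable (H) in
/-- The Schatten class `{A | Tr |A|^p < ∞}`; for `p = 1` these are the trace class operators. -/
def schattenClass (p : ℝ) : Set (H →L[ℂ] H) :=
  {A | posTrace (CFC.abs A ^ p) < ∞}

variable (H) in
/-- The set of states: the positive trace class operators of trace one. -/
def states : Set (H →L[ℂ] H) :=
  {A | A ∈ schattenClass H 1 ∧ A.IsPositive ∧ posTrace A = 1}

/-- The topology of the distance `‖B - A‖_p` on a set `S` of operators: a subset `U` of `S` is open
iff it contains, with each of its points `A`, a ball `{B ∈ S | ‖B - A‖_p < ε}`. -/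
@[reducible]
def schattenTopology (p : ℝ) (S : Set (H →L[ℂ] H)) : TopologicalSpace S where
  IsOpen U := ∀ A ∈ U, ∃ ε : ℝ≥0∞, 0 < ε ∧
    ∀ B : S, schattenNorm p ((B : H →L[ℂ] H) - (A : H →L[ℂ] H)) < ε → B ∈ U
  isOpen_univ := fun _ _ => ⟨1, one_pos, fun _ _ => Set.mem_univ _⟩
  isOpen_inter := fun U V hU hV A hA => by
    obtain ⟨ε, hε, h⟩ := hU A hA.1
    obtain ⟨δ, hδ, h'⟩ := hV A hA.2
    exact ⟨min ε δ, lt_min hε hδ, fun B hB =>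
      ⟨h B (hB.trans_le (min_le_left _ _)), h' B (hB.trans_le (min_le_right _ _))⟩⟩
  isOpen_sUnion := fun s hs A hA => by
    obtain ⟨U, hU, hAU⟩ := hA
    obtain ⟨ε, hε, h⟩ := hs U hU A hAU
    exact ⟨ε, hε, fun B hB => ⟨U, hU, h B hB⟩⟩


end

/-!
Convergence in a Schatten norm implies strong convergence, and for the trace norm strong convergence
together with convergence of the norms is enough (the Radon–Riesz property).

Let `τ` denote `‖A‖₁`, and `tr_s T` the real part of the trace of `T` over a finite set `s` of basis
vectors. By Hölder's inequality `tr_s (M * A) ≤ ‖M‖ * τ`. If `K` and `L` are contractions, `s` and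
`u` are disjoint, `x = tr_s (K * A)` and `y = tr_u (L * A)`, then this applies to
`M = x • P * K + y • (1 - P) * L`, where `P` is the projection onto the span of `s`; since the two
summands have orthogonal ranges, `‖M‖ ^ 2 ≤ x ^ 2 + y ^ 2`, and hence `x ^ 2 + y ^ 2 ≤ τ ^ 2`.

Choose the contraction `K` with `K * A₀ = |A₀|`, and `s` with `tr_s (K * A₀)` close to `‖A₀‖₁`. By
strong convergence `tr_s (K * Aₙ)` is eventually close to `‖Aₙ‖₁`, so the inequality makes
`tr_u (L * A₀)` and `tr_u (L * Aₙ)` small for all contractions `L` and all `u` disjoint from `s`. On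
`s` itself strong convergence suffices, and `‖A₀ - Aₙ‖₁` is a supremum of finite traces of
`L * (A₀ - Aₙ)` for a contraction `L`.
-/

open Filter Topology

theorem exists_norm_le_one_apply_eq_of_norm_le {𝕜 E F G : Type*} [RCLike 𝕜] [AddCommGroup E]
    [Module 𝕜 E] [NormedAddCommGroup F] [NormedSpace 𝕜 F] [CompleteSpace F]
    [NormedAddCommGroup G] [InnerProductSpace 𝕜 G] [CompleteSpace G]
    {B : E →ₗ[𝕜] F} {C : E →ₗ[𝕜] G} (h : ∀ x, ‖B x‖ ≤ ‖C x‖) :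
    ∃ U : G →L[𝕜] F, ‖U‖ ≤ 1 ∧ ∀ x, U (C x) = B x := by
  let R : Submodule 𝕜 G := C.range.topologicalClosure
  have : CompleteSpace R := C.range.isClosed_topologicalClosure.completeSpace_coe
  let e : E →ₗ[𝕜] R := C.codRestrict R fun x => C.range.le_topologicalClosure ⟨x, rfl⟩
  have he : DenseRange e := by
    intro y
    rw [closure_subtype]
    refine closure_mono ?_ (show (y : G) ∈ closure (C.range : Set G) from y.2)
    rintro _ ⟨x, rfl⟩
    exact ⟨e x, ⟨x, rfl⟩, rfl⟩
  have hBe : ∀ x, ‖B x‖ ≤ 1 * ‖e x‖ := fun x => by simpa [e] using h x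
  refine ⟨B.extendOfNorm e ∘L R.orthogonalProjectionOnto, ?_, fun x => ?_⟩
  · exact (ContinuousLinearMap.opNorm_comp_le _ _).trans <| mul_le_one₀
      (LinearMap.opNorm_extendOfNorm_le he zero_le_one hBe) (norm_nonneg _)
      R.orthogonalProjectionOnto_norm_le
  · have hCx : R.orthogonalProjectionOnto (C x) = e x :=
      R.orthogonalProjectionOnto_mem_subspace_eq_self (e x)
    rw [ContinuousLinearMap.comp_apply, hCx, LinearMap.extendOfNorm_eq he ⟨1, hBe⟩]

theorem norm_add_sq_le_of_star_mul_eq_zero {R : Type*} [NonUnitalNormedRing R] [StarRing R]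
    [CStarRing R] {x y : R} (h : star x * y = 0) : ‖x + y‖ ^ 2 ≤ ‖x‖ ^ 2 + ‖y‖ ^ 2 := by
  have h' : star y * x = 0 := by simpa using congrArg star h
  calc ‖x + y‖ ^ 2 = ‖star (x + y) * (x + y)‖ := by rw [CStarRing.norm_star_mul_self, sq]
    _ = ‖star x * x + star y * y‖ := by simp only [star_add, add_mul, mul_add, h, h', add_zero,
        zero_add]
    _ ≤ ‖star x * x‖ + ‖star y * y‖ := norm_add_le _ _
    _ = ‖x‖ ^ 2 + ‖y‖ ^ 2 := by simp only [CStarRing.norm_star_mul_self, sq]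

theorem rpow_le_norm_rpow_smul_rpow {R : Type*} [CStarAlgebra R] [PartialOrder R]
    [StarOrderedRing R] {a : R} (ha : 0 ≤ a) {p q : ℝ} (hp : 0 < p) (hpq : p ≤ q) :
    a ^ q ≤ ‖a‖ ^ (q - p) • a ^ p := by
  nontriviality R
  have hq : 0 < q := hp.trans_le hpq
  have hcont : ∀ r : ℝ, 0 < r → ContinuousOn (fun x : ℝ => x ^ r) (spectrum ℝ a) :=
    fun r hr => (Real.continuous_rpow_const hr.le).continuousOn
  rw [CFC.rpow_eq_cfc_real ha, CFC.rpow_eq_cfc_real ha, ← cfc_smul _ _ a (hcont p hp)]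
  refine cfc_mono (fun x hx => ?_) (hcont q hq) ((hcont p hp).fun_const_smul _)
  have hx0 : 0 ≤ x := spectrum_nonneg_of_nonneg ha hx
  have hxn : x ≤ ‖a‖ := (Real.le_norm_self x).trans (spectrum.norm_le_norm_of_mem hx)
  calc x ^ q = x ^ (q - p) * x ^ p := by
        rw [← Real.rpow_add_of_nonneg hx0 (sub_nonneg.2 hpq) hp.le, sub_add_cancel]
    _ ≤ ‖a‖ ^ (q - p) • x ^ p := by rw [smul_eq_mul]; gcongr

section PolarDecomposition

variable {H : Type*} [NormedAddCommGroup H] [InnerProductSpace ℂ H] [CompleteSpace H]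

theorem re_inner_star_mul_self_apply (S : H →L[ℂ] H) (x : H) :
    (⟪x, (star S * S) x⟫_ℂ).re = ‖S x‖ ^ 2 := by
  rw [mul_apply_eq_comp, ContinuousLinearMap.star_eq_adjoint,
    ContinuousLinearMap.adjoint_inner_right]
  exact inner_self_eq_norm_sq (𝕜 := ℂ) (S x)

theorem norm_abs_apply (A : H →L[ℂ] H) (x : H) : ‖CFC.abs A x‖ = ‖A x‖ := by
  rw [← sq_eq_sq₀ (norm_nonneg _) (norm_nonneg _), ← re_inner_star_mul_self_apply,
    ← re_inner_star_mul_self_apply, (CFC.abs_nonneg A).isSelfAdjoint.star_eq, CFC.abs_mul_abs]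

theorem exists_norm_le_one_mul_eq_abs (A : H →L[ℂ] H) :
    ∃ K : H →L[ℂ] H, ‖K‖ ≤ 1 ∧ K * A = CFC.abs A :=
  (exists_norm_le_one_apply_eq_of_norm_le (B := (CFC.abs A).toLinearMap) (C := A.toLinearMap)
    fun x => (norm_abs_apply A x).le).imp fun _ => And.imp_right ContinuousLinearMap.ext

theorem exists_norm_le_one_mul_abs_eq (A : H →L[ℂ] H) :
    ∃ U : H →L[ℂ] H, ‖U‖ ≤ 1 ∧ U * CFC.abs A = A :=
  (exists_norm_le_one_apply_eq_of_norm_le (B := A.toLinearMap) (C := (CFC.abs A).toLinearMap)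
    fun x => (norm_abs_apply A x).ge).imp fun _ => And.imp_right ContinuousLinearMap.ext

end PolarDecomposition

section PosTrace

variable {H : Type*} [NormedAddCommGroup H] [InnerProductSpace ℂ H] [CompleteSpace H]

theorem posTrace_mono {S T : H →L[ℂ] H} (h : S ≤ T) : posTrace S ≤ posTrace T := by
  refine ENNReal.tsum_le_tsum fun i => ENNReal.ofReal_le_ofReal ?_
  generalize ((exists_hilbertBasis ℂ H).choose_spec.choose i : H) = x
  simpa [inner_sub_right] using ((ContinuousLinearMap.le_def S T).1 h).re_inner_nonneg_right x

theorem posTrace_smul {c : ℝ} (hc : 0 ≤ c) (T : H →L[ℂ] H) :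
    posTrace (c • T) = ENNReal.ofReal c * posTrace T := by
  rw [posTrace, posTrace, ← ENNReal.tsum_mul_left]
  refine tsum_congr fun i => ?_
  rw [← ENNReal.ofReal_mul hc, smul_apply, inner_smul_right_eq_smul, Complex.smul_re, smul_eq_mul]

theorem posTrace_star_mul_self {ι : Type*} (b : HilbertBasis ι ℂ H) (S : H →L[ℂ] H) :
    posTrace (star S * S) = ∑' i, ENNReal.ofReal (‖S (b i)‖ ^ 2) := by
  rw [posTrace_eq_tsum b ((ContinuousLinearMap.nonneg_iff_isPositive _).1 (star_mul_self_nonneg S))]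
  simp_rw [re_inner_star_mul_self_apply]

theorem posTrace_star_mul_self_comm (S : H →L[ℂ] H) :
    posTrace (star S * S) = posTrace (S * star S) := by
  obtain ⟨_, b, -⟩ := exists_hilbertBasis ℂ H
  have h := posTrace_star_mul_self b (star S)
  rw [star_star] at h
  rw [h, posTrace_star_mul_self b]
  simp_rw [← b.tsum_enorm_inner_sq]
  rw [ENNReal.tsum_comm]
  simp_rw [ContinuousLinearMap.star_eq_adjoint, ContinuousLinearMap.adjoint_inner_right,
    norm_inner_symm]

theorem posTrace_star_mul_self_mul_le (S V : H →L[ℂ] H) :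
    posTrace (star (S * V) * (S * V)) ≤ ENNReal.ofReal (‖V‖ ^ 2) * posTrace (star S * S) := by
  rw [posTrace_star_mul_self_comm, posTrace_star_mul_self_comm S, ← posTrace_smul (sq_nonneg ‖V‖)]
  refine posTrace_mono ?_
  have h := star_right_conjugate_le_conjugate
    (CStarAlgebra.mul_star_le_algebraMap_norm_sq (a := V)) S
  simpa only [star_mul, mul_assoc, Algebra.algebraMap_eq_smul_one, smul_mul_assoc, mul_smul_comm,
    one_mul] using h

theorem ofReal_re_inner_le_posTrace {T : H →L[ℂ] H} (hT : 0 ≤ T) {x : H} (hx : ‖x‖ = 1) :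
    ENNReal.ofReal (⟪x, T x⟫_ℂ).re ≤ posTrace T := by
  have hx' : Orthonormal ℂ ((↑) : ({x} : Set H) → H) := by
    simpa [orthonormal_subtype_iff_ite] using hx
  obtain ⟨w, b, hxw, hb⟩ := hx'.exists_hilbertBasis_extension
  rw [posTrace_eq_tsum b ((ContinuousLinearMap.nonneg_iff_isPositive T).1 hT)]
  simpa [hb] using ENNReal.le_tsum (f := fun i => ENNReal.ofReal (⟪b i, T (b i)⟫_ℂ).re)
    ⟨x, hxw rfl⟩

theorem ofReal_norm_le_posTrace {T : H →L[ℂ] H} (hT : 0 ≤ T) :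
    ENNReal.ofReal ‖T‖ ≤ posTrace T := by
  rcases eq_or_ne (posTrace T) ∞ with h | h
  · exact h ▸ le_top
  rw [ENNReal.ofReal_le_iff_le_toReal h, ← Real.sqrt_le_sqrt_iff ENNReal.toReal_nonneg,
    ← CFC.norm_sqrt T]
  refine ContinuousLinearMap.opNorm_le_of_unit_norm (Real.sqrt_nonneg _) fun x hx =>
    Real.le_sqrt_of_sq_le ?_
  rw [← re_inner_star_mul_self_apply, (CFC.sqrt_nonneg T).isSelfAdjoint.star_eq,
    CFC.sqrt_mul_sqrt_self T]
  exact (ENNReal.ofReal_le_iff_le_toReal h).1 (ofReal_re_inner_le_posTrace hT hx)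

end PosTrace
section PartialTrace

variable {H : Type*} [NormedAddCommGroup H] [InnerProductSpace ℂ H] {ι : Type*} {v : ι → H}

/-- The real part of the trace of the compression of an operator to the finite subfamily
`(v i)_{i ∈ s}` of an orthonormal family `v`. These real-linear forms express the trace norm by
duality, which avoids the trace of operators that are not positive. -/
noncomputable def partialTrace (v : ι → H) (s : Finset ι) : (H →L[ℂ] H) →ₗ[ℝ] ℝ where
  toFun T := ∑ i ∈ s, (⟪v i, T (v i)⟫_ℂ).re
  map_add' S T := by
    simp only [add_apply, inner_add_right, Complex.add_re, Finset.sum_add_distrib]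
  map_smul' c T := by
    simp only [smul_apply, inner_smul_right_eq_smul, Complex.smul_re, ← Finset.smul_sum,
      RingHom.id_apply]

theorem partialTrace_apply (v : ι → H) (s : Finset ι) (T : H →L[ℂ] H) :
    partialTrace v s T = ∑ i ∈ s, (⟪v i, T (v i)⟫_ℂ).re :=
  rfl

theorem partialTrace_mul_le_sum_norm (hv : ∀ i, ‖v i‖ = 1) {L : H →L[ℂ] H} (hL : ‖L‖ ≤ 1)
    (t : Finset ι) (B : H →L[ℂ] H) : partialTrace v t (L * B) ≤ ∑ i ∈ t, ‖B (v i)‖ := by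
  refine Finset.sum_le_sum fun i _ => ?_
  calc (⟪v i, L (B (v i))⟫_ℂ).re ≤ ‖v i‖ * ‖L (B (v i))‖ :=
        (Complex.re_le_norm _).trans (norm_inner_le_norm _ _)
    _ ≤ ‖B (v i)‖ := by
        rw [hv i, one_mul]
        exact (L.le_of_opNorm_le hL _).trans_eq (one_mul _)

theorem starProjection_span_image_apply (hv : Orthonormal ℂ v) (s : Set ι)
    [DecidablePred (· ∈ s)] [(Submodule.span ℂ (v '' s)).HasOrthogonalProjection] (i : ι) :
    (Submodule.span ℂ (v '' s)).starProjection (v i) = if i ∈ s then v i else 0 := by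
  split_ifs with hi
  · exact Submodule.starProjection_eq_self_iff.2 (Submodule.subset_span ⟨i, hi, rfl⟩)
  · rw [Submodule.starProjection_apply_eq_zero_iff, Submodule.mem_orthogonal]
    refine fun u hu => Submodule.span_induction ?_ (inner_zero_left _)
      (fun x y _ _ hx hy => by rw [inner_add_left, hx, hy, add_zero])
      (fun a x _ hx => by rw [inner_smul_left, hx, mul_zero]) hu
    rintro _ ⟨j, hj, rfl⟩
    exact hv.2 fun h => hi (h ▸ hj)

theorem partialTrace_starProjection_mul [DecidableEq ι] (hv : Orthonormal ℂ v) (s t : Finset ι)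
    [(Submodule.span ℂ (v '' s)).HasOrthogonalProjection] (T : H →L[ℂ] H) :
    partialTrace v t ((Submodule.span ℂ (v '' s)).starProjection * T) =
      partialTrace v (t ∩ s) T := by
  simp only [partialTrace_apply, mul_apply_eq_comp,
    ← Submodule.inner_starProjection_left_eq_right, starProjection_span_image_apply hv,
    Finset.mem_coe, ← Finset.sum_ite_mem t s]
  refine Finset.sum_congr rfl fun i _ => ?_
  split_ifs
  · rfl
  · rw [inner_zero_left, Complex.zero_re]

theorem tendsto_partialTrace_mul {α : Type*} {l : Filter α} {A₀ : H →L[ℂ] H} {A : α → H →L[ℂ] H}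
    (hA : ∀ x, Tendsto (fun n => A n x) l (𝓝 (A₀ x))) (v : ι → H) (s : Finset ι) (K : H →L[ℂ] H) :
    Tendsto (fun n => partialTrace v s (K * A n)) l (𝓝 (partialTrace v s (K * A₀))) :=
  tendsto_finsetSum _ fun _ _ => (Complex.continuous_re.tendsto _).comp <|
    tendsto_const_nhds.inner ((K.continuous.tendsto _).comp (hA _))

theorem ofReal_partialTrace (v : ι → H) (s : Finset ι) {T : H →L[ℂ] H} (hT : T.IsPositive) :
    ENNReal.ofReal (partialTrace v s T) = ∑ i ∈ s, ENNReal.ofReal (⟪v i, T (v i)⟫_ℂ).re :=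
  ENNReal.ofReal_sum_of_nonneg fun i _ => hT.re_inner_nonneg_right (v i)

variable [CompleteSpace H]

theorem partialTrace_star_mul_self (v : ι → H) (s : Finset ι) (S : H →L[ℂ] H) :
    partialTrace v s (star S * S) = ∑ i ∈ s, ‖S (v i)‖ ^ 2 := by
  simp_rw [partialTrace_apply, re_inner_star_mul_self_apply]

theorem partialTrace_star_mul_le (v : ι → H) (s : Finset ι) (S T : H →L[ℂ] H) :
    partialTrace v s (star S * T) ≤
      √(partialTrace v s (star S * S)) * √(partialTrace v s (star T * T)) := by
  rw [partialTrace_star_mul_self, partialTrace_star_mul_self]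
  refine (Finset.sum_le_sum fun i _ => ?_).trans (Real.sum_mul_le_sqrt_mul_sqrt s _ _)
  rw [mul_apply_eq_comp, ContinuousLinearMap.star_eq_adjoint,
    ContinuousLinearMap.adjoint_inner_right]
  exact (Complex.re_le_norm _).trans (norm_inner_le_norm _ _)

theorem tendsto_ofReal_partialTrace (b : HilbertBasis ι ℂ H) {T : H →L[ℂ] H}
    (hT : T.IsPositive) :
    Tendsto (fun s => ENNReal.ofReal (partialTrace b s T)) atTop (𝓝 (posTrace T)) := by
  simp_rw [ofReal_partialTrace b _ hT, posTrace_eq_tsum b hT]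
  exact ENNReal.summable.hasSum

theorem ofReal_partialTrace_le_posTrace (b : HilbertBasis ι ℂ H) (s : Finset ι) {T : H →L[ℂ] H}
    (hT : T.IsPositive) : ENNReal.ofReal (partialTrace b s T) ≤ posTrace T := by
  rw [ofReal_partialTrace b s hT, posTrace_eq_tsum b hT]
  exact ENNReal.sum_le_tsum s

theorem norm_smul_starProjection_mul_add_sq_le (E : Submodule ℂ H) [E.HasOrthogonalProjection]
    {K L : H →L[ℂ] H} (hK : ‖K‖ ≤ 1) (hL : ‖L‖ ≤ 1) (x y : ℝ) :
    ‖x • (E.starProjection * K) + y • (Eᗮ.starProjection * L)‖ ^ 2 ≤ x ^ 2 + y ^ 2 := by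
  have hbound : ∀ {P M : H →L[ℂ] H}, ‖P‖ ≤ 1 → ‖M‖ ≤ 1 → ∀ c : ℝ, ‖c • (P * M)‖ ^ 2 ≤ c ^ 2 := by
    intro P M hP hM c
    rw [norm_smul, mul_pow, Real.norm_eq_abs, sq_abs]
    exact mul_le_of_le_one_right (sq_nonneg c) <| pow_le_one₀ (norm_nonneg _) <|
      (norm_mul_le _ _).trans (mul_le_one₀ hP (norm_nonneg _) hM)
  have horth : E.starProjection * Eᗮ.starProjection = 0 := by
    rw [Submodule.starProjection_orthogonal', mul_sub, mul_one,
      E.isIdempotentElem_starProjection.eq, sub_self]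
  refine (norm_add_sq_le_of_star_mul_eq_zero ?_).trans <|
    add_le_add (hbound E.starProjection_norm_le hK x) (hbound Eᗮ.starProjection_norm_le hL y)
  rw [star_smul, star_mul, isStarProjection_starProjection.isSelfAdjoint.star_eq,
    smul_mul_smul_comm, mul_assoc, ← mul_assoc E.starProjection, horth, zero_mul, mul_zero,
    smul_zero]

end PartialTrace

section SchattenNorm

variable {H : Type*} [NormedAddCommGroup H] [InnerProductSpace ℂ H] [CompleteSpace H]
  {ι : Type*}

theorem schattenNorm_one (A : H →L[ℂ] H) : schattenNorm 1 A = posTrace (CFC.abs A) := by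
  rw [schattenNorm, CFC.rpow_one _ (CFC.abs_nonneg A), div_one, ENNReal.rpow_one]

theorem schattenNorm_sub_comm (p : ℝ) (A B : H →L[ℂ] H) :
    schattenNorm p (A - B) = schattenNorm p (B - A) := by
  rw [schattenNorm, schattenNorm, ← neg_sub, CFC.abs_neg]

theorem ofReal_norm_le_schattenNorm {p : ℝ} (hp : 0 < p) (A : H →L[ℂ] H) :
    ENNReal.ofReal ‖A‖ ≤ schattenNorm p A := by
  rw [schattenNorm, one_div, ENNReal.le_rpow_inv_iff hp,
    ENNReal.ofReal_rpow_of_nonneg (norm_nonneg _) hp.le, ← CFC.norm_abs,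
    ← CFC.norm_rpow _ hp (CFC.abs_nonneg A)]
  exact ofReal_norm_le_posTrace CFC.rpow_nonneg

theorem schattenNorm_antitoneOn (A : H →L[ℂ] H) :
    AntitoneOn (fun p => schattenNorm p A) (Set.Ioi 0) := by
  intro p (hp : 0 < p) q (hq : 0 < q) hpq
  have hpq' : 0 ≤ q - p := sub_nonneg.2 hpq
  change schattenNorm q A ≤ schattenNorm p A
  rw [schattenNorm, one_div, ENNReal.rpow_inv_le_iff hq]
  calc posTrace (CFC.abs A ^ q) ≤ posTrace (‖CFC.abs A‖ ^ (q - p) • CFC.abs A ^ p) :=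
        posTrace_mono (rpow_le_norm_rpow_smul_rpow (CFC.abs_nonneg A) hp hpq)
    _ = ENNReal.ofReal ‖A‖ ^ (q - p) * schattenNorm p A ^ p := by
        rw [posTrace_smul (by positivity), CFC.norm_abs, schattenNorm, one_div,
          ENNReal.rpow_inv_rpow hp.ne', ENNReal.ofReal_rpow_of_nonneg (norm_nonneg _) hpq']
    _ ≤ schattenNorm p A ^ (q - p) * schattenNorm p A ^ p := by
        gcongr
        exact ofReal_norm_le_schattenNorm hp A
    _ = schattenNorm p A ^ q := by
        rw [← ENNReal.rpow_add_of_nonneg _ _ hpq' hp.le, sub_add_cancel]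

theorem partialTrace_mul_le_norm_mul_schattenNorm_one (b : HilbertBasis ι ℂ H) (s : Finset ι)
    (M : H →L[ℂ] H) {A : H →L[ℂ] H} (hA : schattenNorm 1 A ≠ ∞) :
    partialTrace b s (M * A) ≤ ‖M‖ * (schattenNorm 1 A).toReal := by
  obtain ⟨U, hU, hUA⟩ := exists_norm_le_one_mul_abs_eq A
  set S := CFC.sqrt (CFC.abs A)
  have hstar : star S = S := (CFC.sqrt_nonneg (CFC.abs A)).isSelfAdjoint.star_eq
  have hSS : star S * S = CFC.abs A := by rw [hstar, CFC.sqrt_mul_sqrt_self _ (CFC.abs_nonneg A)]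
  set τ := (schattenNorm 1 A).toReal
  have hτ : posTrace (star S * S) = ENNReal.ofReal τ := by
    rw [hSS, ← schattenNorm_one, ENNReal.ofReal_toReal hA]
  set V := star (M * U)
  have hV : ‖V‖ ≤ ‖M‖ := by
    rw [norm_star]
    exact (norm_mul_le M U).trans (mul_le_of_le_one_right (norm_nonneg M) hU)
  have hfactor : M * A = star (S * V) * S := by
    rw [star_mul, star_star, mul_assoc, hSS, mul_assoc, hUA]
  have hle : ∀ {T : H →L[ℂ] H} {c : ℝ}, 0 ≤ c → posTrace (star T * T) ≤ ENNReal.ofReal c →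
      partialTrace b s (star T * T) ≤ c := fun hc h => (ENNReal.ofReal_le_ofReal_iff hc).1 <|
    (ofReal_partialTrace_le_posTrace b s <|
      (ContinuousLinearMap.nonneg_iff_isPositive _).1 (star_mul_self_nonneg _)).trans h
  have hSV : partialTrace b s (star (S * V) * (S * V)) ≤ ‖M‖ ^ 2 * τ := by
    refine hle (by positivity) ((posTrace_star_mul_self_mul_le S V).trans ?_)
    rw [hτ, ENNReal.ofReal_mul (sq_nonneg _)]
    gcongr
  have hS : partialTrace b s (star S * S) ≤ τ := hle ENNReal.toReal_nonneg hτ.le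
  calc partialTrace b s (M * A) ≤ √(partialTrace b s (star (S * V) * (S * V))) *
        √(partialTrace b s (star S * S)) := hfactor ▸ partialTrace_star_mul_le b s (S * V) S
    _ ≤ √(‖M‖ ^ 2 * τ) * √τ := by gcongr
    _ = ‖M‖ * τ := by
        rw [Real.sqrt_mul (sq_nonneg _), Real.sqrt_sq (norm_nonneg M), mul_assoc,
          Real.mul_self_sqrt ENNReal.toReal_nonneg]

theorem tendsto_partialTrace_abs (b : HilbertBasis ι ℂ H) {A : H →L[ℂ] H}
    (hA : schattenNorm 1 A ≠ ∞) :
    Tendsto (fun s => partialTrace b s (CFC.abs A)) atTop (𝓝 (schattenNorm 1 A).toReal) := by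
  have habs := (ContinuousLinearMap.nonneg_iff_isPositive _).1 (CFC.abs_nonneg A)
  have hnonneg : ∀ s, 0 ≤ partialTrace b s (CFC.abs A) := fun s =>
    Finset.sum_nonneg fun i _ => habs.re_inner_nonneg_right (b i)
  rw [schattenNorm_one] at hA ⊢
  simpa only [Function.comp_def, ENNReal.toReal_ofReal (hnonneg _)] using
    (ENNReal.tendsto_toReal hA).comp (tendsto_ofReal_partialTrace b habs)

theorem partialTrace_mul_sq_add_sq_le (b : HilbertBasis ι ℂ H) {A K L : H →L[ℂ] H}
    (hA : schattenNorm 1 A ≠ ∞) (hK : ‖K‖ ≤ 1) (hL : ‖L‖ ≤ 1) {s u : Finset ι}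
    (hsu : Disjoint s u) :
    partialTrace b s (K * A) ^ 2 + partialTrace b u (L * A) ^ 2 ≤
      (schattenNorm 1 A).toReal ^ 2 := by
  classical
  set x := partialTrace b s (K * A)
  set y := partialTrace b u (L * A)
  set τ := (schattenNorm 1 A).toReal
  let E : Submodule ℂ H := Submodule.span ℂ (b '' s)
  have : FiniteDimensional ℂ E := .span_of_finite ℂ (s.finite_toSet.image b)
  -- The coefficients are those for which the partial trace of `M * A` is a sum of squares.
  let M : H →L[ℂ] H := x • (E.starProjection * K) + y • (Eᗮ.starProjection * L)
  have hM : ‖M‖ ^ 2 ≤ x ^ 2 + y ^ 2 := norm_smul_starProjection_mul_add_sq_le E hK hL x y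
  have hMA : partialTrace b (s ∪ u) (M * A) = x ^ 2 + y ^ 2 := by
    have hE : ∀ T, partialTrace b (s ∪ u) (E.starProjection * T) = partialTrace b s T := by
      intro T
      rw [partialTrace_starProjection_mul b.orthonormal, Finset.union_inter_cancel_left]
    have hE' : ∀ T, partialTrace b (s ∪ u) (Eᗮ.starProjection * T) = partialTrace b u T := by
      intro T
      rw [Submodule.starProjection_orthogonal', sub_mul, one_mul, map_sub, hE, sub_eq_iff_eq_add']
      exact Finset.sum_union hsu
    rw [add_mul, smul_mul_assoc, smul_mul_assoc, mul_assoc, mul_assoc, map_add, map_smul, map_smul,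
      hE, hE', smul_eq_mul, smul_eq_mul, ← sq, ← sq]
  have hHolder : x ^ 2 + y ^ 2 ≤ ‖M‖ * τ :=
    hMA ▸ partialTrace_mul_le_norm_mul_schattenNorm_one b (s ∪ u) M hA
  nlinarith [norm_nonneg M, sq_nonneg (‖M‖ - τ)]

theorem schattenNorm_one_sub_le (b : HilbertBasis ι ℂ H) {A B K : H →L[ℂ] H}
    (hA : schattenNorm 1 A ≠ ∞) (hB : schattenNorm 1 B ≠ ∞) (hK : ‖K‖ ≤ 1) (s : Finset ι) :
    schattenNorm 1 (A - B) ≤ ENNReal.ofReal (∑ i ∈ s, ‖(A - B) (b i)‖ +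
      √((schattenNorm 1 A).toReal ^ 2 - partialTrace b s (K * A) ^ 2) +
      √((schattenNorm 1 B).toReal ^ 2 - partialTrace b s (K * B) ^ 2)) := by
  classical
  obtain ⟨L, hL, hLabs⟩ := exists_norm_le_one_mul_eq_abs (A - B)
  have hlim := tendsto_ofReal_partialTrace b <|
    (ContinuousLinearMap.nonneg_iff_isPositive _).1 (CFC.abs_nonneg (A - B))
  rw [← schattenNorm_one, ← hLabs] at hlim
  refine le_of_tendsto' hlim fun t => ENNReal.ofReal_le_ofReal ?_
  have hdisj : Disjoint s (t \ s) := Finset.disjoint_sdiff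
  have hinside : partialTrace b (t ∩ s) (L * (A - B)) ≤ ∑ i ∈ s, ‖(A - B) (b i)‖ :=
    (partialTrace_mul_le_sum_norm b.orthonormal.1 hL _ _).trans <|
      Finset.sum_le_sum_of_subset_of_nonneg Finset.inter_subset_right fun _ _ _ => norm_nonneg _
  have houtside : ∀ {C N : H →L[ℂ] H}, schattenNorm 1 C ≠ ∞ → ‖N‖ ≤ 1 →
      partialTrace b (t \ s) (N * C) ≤
        √((schattenNorm 1 C).toReal ^ 2 - partialTrace b s (K * C) ^ 2) := fun hC hN =>
    Real.le_sqrt_of_sq_le (le_sub_iff_add_le'.2 (partialTrace_mul_sq_add_sq_le b hC hK hN hdisj))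
  calc partialTrace b t (L * (A - B))
      = partialTrace b (t ∩ s) (L * (A - B)) + partialTrace b (t \ s) (L * (A - B)) :=
        (Finset.sum_inter_add_sum_sdiff t s _).symm
    _ = partialTrace b (t ∩ s) (L * (A - B)) + partialTrace b (t \ s) (L * A) +
          partialTrace b (t \ s) (-L * B) := by
        rw [add_assoc, ← map_add, neg_mul, ← sub_eq_add_neg, mul_sub]
    _ ≤ _ := by
        gcongr
        exacts [houtside hA hL, houtside hB (by rwa [norm_neg])]

end SchattenNorm
section RadonRiesz

variable {H : Type*} [NormedAddCommGroup H] [InnerProductSpace ℂ H] [CompleteSpace H]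
  {α : Type*} {l : Filter α} {A₀ : H →L[ℂ] H} {A : α → H →L[ℂ] H}

theorem tendsto_schattenNorm_one_sub (h₀ : schattenNorm 1 A₀ ≠ ∞)
    (hnorm : Tendsto (fun n => schattenNorm 1 (A n)) l (𝓝 (schattenNorm 1 A₀)))
    (hA : ∀ x, Tendsto (fun n => A n x) l (𝓝 (A₀ x))) :
    Tendsto (fun n => schattenNorm 1 (A₀ - A n)) l (𝓝 0) := by
  obtain ⟨_, b, -⟩ := exists_hilbertBasis ℂ H
  obtain ⟨K, hK, hKabs⟩ := exists_norm_le_one_mul_eq_abs A₀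
  let defect s B := √((schattenNorm 1 B).toReal ^ 2 - partialTrace b s (K * B) ^ 2)
  have hfin : ∀ᶠ n in l, schattenNorm 1 (A n) ≠ ∞ := hnorm.eventually_ne h₀
  have hdefect₀ : Tendsto (fun s => defect s A₀) atTop (𝓝 0) := by
    have h := (((tendsto_partialTrace_abs b h₀).pow 2).const_sub
      ((schattenNorm 1 A₀).toReal ^ 2)).sqrt
    rw [sub_self, Real.sqrt_zero] at h
    simpa only [defect, hKabs] using h
  have hdefect : ∀ s, Tendsto (fun n => defect s (A n)) l (𝓝 (defect s A₀)) := fun s =>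
    ((((ENNReal.tendsto_toReal h₀).comp hnorm).pow 2).sub
      ((tendsto_partialTrace_mul hA b s K).pow 2)).sqrt
  have hinside : ∀ s : Finset _, Tendsto (fun n => ∑ i ∈ s, ‖(A₀ - A n) (b i)‖) l (𝓝 0) := by
    intro s
    simpa using tendsto_finsetSum s fun i _ => ((hA (b i)).const_sub (A₀ (b i))).norm
  refine ENNReal.tendsto_nhds_zero.2 fun ε hε => ?_
  have hsmall : Tendsto (fun s => ENNReal.ofReal (0 + defect s A₀ + defect s A₀)) atTop (𝓝 0) := by
    simpa using ENNReal.tendsto_ofReal ((hdefect₀.const_add 0).add hdefect₀)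
  obtain ⟨s, hs⟩ := (hsmall.eventually_lt_const hε).exists
  have hbound := ENNReal.tendsto_ofReal (((hinside s).add_const (defect s A₀)).add (hdefect s))
  filter_upwards [hbound.eventually_lt_const hs, hfin] with n hn hfin
  exact (schattenNorm_one_sub_le b h₀ hfin hK s).trans hn.le

theorem tendsto_apply_of_tendsto_schattenNorm_sub {p : ℝ} (hp : 0 < p)
    (hA : Tendsto (fun n => schattenNorm p (A₀ - A n)) l (𝓝 0)) (x : H) :
    Tendsto (fun n => A n x) l (𝓝 (A₀ x)) := by
  have hnorm : Tendsto A l (𝓝 A₀) := by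
    refine tendsto_iff_edist_tendsto_0.2 <| tendsto_of_tendsto_of_tendsto_of_le_of_le
      tendsto_const_nhds hA (fun _ => zero_le) fun n => ?_
    simpa only [edist_comm, edist_eq_enorm_sub, ofReal_norm] using
      ofReal_norm_le_schattenNorm hp (A₀ - A n)
  exact ((ContinuousLinearMap.apply ℂ H x).continuous.tendsto A₀).comp hnorm

end RadonRiesz

section SchattenTopology

variable {H : Type*} [NormedAddCommGroup H] [InnerProductSpace ℂ H] [CompleteSpace H]

theorem schattenTopology_le_of_tendsto {p q : ℝ} {S : Set (H →L[ℂ] H)}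
    (h : ∀ A : S, Tendsto (fun B : S => schattenNorm q (B - A : H →L[ℂ] H))
      (comap (fun B : S => schattenNorm p (B - A : H →L[ℂ] H)) (𝓝 0)) (𝓝 0)) :
    schattenTopology p S ≤ schattenTopology q S := by
  intro U hU A hA
  obtain ⟨ε, hε, hball⟩ := hU A hA
  obtain ⟨δ, hδ, hsub⟩ :=
    ((ENNReal.nhds_zero_basis.comap _).tendsto_iff ENNReal.nhds_zero_basis).1 (h A) ε hε
  exact ⟨δ, hδ, fun B hB => hball B (hsub B hB)⟩

theorem schattenNorm_one_of_mem_states {A : H →L[ℂ] H} (hA : A ∈ states H) :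
    schattenNorm 1 A = 1 := by
  have hA₀ : 0 ≤ A := (ContinuousLinearMap.nonneg_iff_isPositive A).2 hA.2.1
  rw [schattenNorm_one, CFC.abs_of_nonneg A hA₀, hA.2.2]

end SchattenTopology

theorem corollary1_general {H : Type*} [NormedAddCommGroup H] [InnerProductSpace ℂ H]
    [CompleteSpace H] {p : ℝ} (hp : 1 ≤ p) :
    (∀ {α : Type*} {l : Filter α} {A₀ : H →L[ℂ] H} {A : α → H →L[ℂ] H},
      schattenNorm 1 A₀ ≠ ∞ →
      Tendsto (fun n => schattenNorm 1 (A n)) l (𝓝 (schattenNorm 1 A₀)) →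
      Tendsto (fun n => schattenNorm p (A₀ - A n)) l (𝓝 0) →
      Tendsto (fun n => schattenNorm 1 (A₀ - A n)) l (𝓝 0)) ∧
    ∀ {S : Set (H →L[ℂ] H)} {τ : ℝ≥0∞}, τ ≠ ∞ → (∀ A ∈ S, schattenNorm 1 A = τ) →
      schattenTopology 1 S = schattenTopology p S := by
  have hp₀ : 0 < p := one_pos.trans_le hp
  refine ⟨fun h₀ hnorm hA => tendsto_schattenNorm_one_sub h₀ hnorm
    (tendsto_apply_of_tendsto_schattenNorm_sub hp₀ hA), fun {S τ} hτ hS => le_antisymm ?_ ?_⟩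
  · exact schattenTopology_le_of_tendsto fun A => tendsto_of_tendsto_of_tendsto_of_le_of_le
      tendsto_const_nhds tendsto_comap (fun _ => zero_le)
      fun B => schattenNorm_antitoneOn (B - A : H →L[ℂ] H) (Set.mem_Ioi.2 one_pos) hp₀ hp
  · refine schattenTopology_le_of_tendsto fun A => ?_
    simp_rw [schattenNorm_sub_comm _ _ (A : H →L[ℂ] H)]
    refine tendsto_schattenNorm_one_sub (hS A A.2 ▸ hτ) ?_
      (tendsto_apply_of_tendsto_schattenNorm_sub hp₀ tendsto_comap)
    simp_rw [hS _ (Subtype.prop _)]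
    exact tendsto_const_nhds

open Filter Topology in
theorem corollary1 {H : Type*} [NormedAddCommGroup H] [InnerProductSpace ℂ H] [CompleteSpace H]
    (p : ℝ) (hp : 1 < p) :
    (∀ (A₀ : H →L[ℂ] H) (A : ℕ → H →L[ℂ] H),
      A₀ ∈ schattenClass H 1 → (∀ n, A n ∈ schattenClass H 1) →
      IsStarNormal A₀ →
      schattenNorm 1 A₀ = 1 → (∀ n, schattenNorm 1 (A n) = 1) →
      Tendsto (fun n => schattenNorm p (A₀ - A n)) atTop (𝓝 0) →
      Tendsto (fun n => schattenNorm 1 (A₀ - A n)) atTop (𝓝 0)) ∧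
    schattenTopology 1 (states H) = schattenTopology p (states H) :=
  (corollary1_general hp.le).imp
    (fun h A₀ A _ _ _ h₀ hA => h (by simp [h₀]) (by simp [h₀, hA]))
    (fun h => h ENNReal.one_ne_top fun _ => schattenNorm_one_of_mem_states)
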